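/- Let $\mathsf{Mon}$ be the category of monads on $\mathsf{Set}$. For a monad $R$, a (left) $R$-module is a functor $M:\mathsf{Set}\to\mathsf{Set}$ with a natural transformation $\rho^M: M\cdot R\to M$ such that $\rho^M\circ\rho^M R=\rho^M\circ M\mu$ and $\rho^M\circ M\eta=1_M$; a morphism $\tau:M\to N$ of $R$-modules is a natural transformation with $\tau\circ\rho^M=\rho^N\circ\tau R$. For a monad morphism $f:R\to S$ and an $S$-module $N$, let $f^*N$ be the functor $N$ with substitution $N\cdot R\xrightarrow{Nf}N\cdot S\xrightarrow{\rho^N}N$. Let $\int\mathsf{Mod}$ be the category of pairs $(R,M)$ of a monad $R$ and an $R$-module $M$, a morphism $(R,M)\to(S,N)$ being a pair of a monad morphism $f:R\to S$ and a morphism of $R$-modules $M\to f^*N$. A *signature* is a section $\Sigma$ of the forgetful functor $\int\mathsf{Mod}\to\mathsf{Mon}$, and a morphism of signatures is a natural transformation that lies over the identity of $\mathsf{Mon}$. For an $R$-module $M$, the *derivative* $M'$ is the functor $X\mapsto M(X+*)$ with substitution $M(R(X)+*)\to M(R(X+*))\xrightarrow{\rho^M}M(X+*)$, whose first arrow is $M$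 applied to the map given by $R$ of the inclusion $X\to X+*$ and by the unit of $R$ at the added point; $M^{(k)}$ is the $k$-th iterated derivative. For a finite, possibly empty, list $s=(s_1,\dots,s_n)$ of nonnegative integers, the *elementary signature* $\Theta^{(s)}$ is $R\mapsto R^{(s_1)}\times\cdots\times R^{(s_n)}$, where $R$ is regarded as a module over itself. An *algebraic signature* is a (possibly infinite) set-indexed coproduct of elementary signatures in the category of signatures. A *model* of a signature $\Sigma$ is a monad $R$ with a morphism of $R$-modules $r:\Sigma(R)\to R$; a morphism of models $(R,r)\to(S,s)$ is a monad morphism $m:R\to S$ with $m\circ r=s\circ\Sigma(m)$. A signature is *representable* if its category of models has an initial object. **Statement.** Let $J$ be a small category and $F$ a functor from $J$ to the category of signatures such that $F(j)$ is an algebraic signature for every object $j$ of $J$. Then every colimit of $F$ in the category of signatures is representable. -/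

import Mathlib

open CategoryTheory CategoryTheory.Limits

universe u

/-- Monads on the category of sets, with monad morphisms: the category `Mon`. -/
abbrev SetMonad : Type (u + 1) := CategoryTheory.Monad (Type u)

/-! ### Modules over a monad -/

/-- A (left) module over a monad `R`: a functor `M : Set ⥤ Set` with a natural transformation
`M · R ⟶ M` (module substitution) compatible with the multiplication and the unit of `R`. -/
structure MonadModule (R : SetMonad.{u}) where
  functor : Type u ⥤ Type u
  act : R.toFunctor ⋙ functor ⟶ functor
  act_act : ∀ X : Type u,
    act.app (R.obj X) ≫ act.app X = functor.map (R.μ.app X) ≫ act.app X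
  act_unit : ∀ X : Type u, functor.map (R.η.app X) ≫ act.app X = 𝟙 (functor.obj X)

namespace MonadModule

/-- Linear natural transformations between modules over the same monad. -/
@[ext]
structure Hom {R : SetMonad.{u}} (M N : MonadModule R) where
  nat : M.functor ⟶ N.functor
  linear : ∀ X : Type u, M.act.app X ≫ nat.app X = nat.app (R.obj X) ≫ N.act.app X

/-- The category `Mod(R)`. -/
instance category (R : SetMonad.{u}) : Category (MonadModule R) where
  Hom M N := Hom M N
  id M := { nat := 𝟙 M.functor, linear := fun X => by simp }
  comp f g :=
    { nat := f.nat ≫ g.nat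
      linear := fun X => by
        have hf := f.linear X
        have hg := g.linear X
        simp only [NatTrans.comp_app, Category.assoc]
        rw [← hg, ← Category.assoc, hf, Category.assoc] }

@[ext]
theorem hom_ext {R : SetMonad.{u}} {M N : MonadModule R} (f g : M ⟶ N) (h : f.nat = g.nat) :
    f = g :=
  Hom.ext h

@[simp]
theorem id_nat {R : SetMonad.{u}} (M : MonadModule R) : Hom.nat (𝟙 M) = 𝟙 M.functor := rfl

@[simp]
theorem comp_nat {R : SetMonad.{u}} {M N P : MonadModule R} (f : M ⟶ N) (g : N ⟶ P) :
    Hom.nat (f ≫ g) = f.nat ≫ g.nat := rfl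

/-- Every monad is a module over itself. -/
@[simps]
abbrev tautological (R : SetMonad.{u}) : MonadModule R where
  functor := R.toFunctor
  act := R.μ
  act_act X := (R.assoc X).symm
  act_unit X := R.right_unit X

/-- The pullback `f^* : Mod(S) ⥤ Mod(R)` along a morphism of monads `f : R ⟶ S`: the underlying
functor is kept, and the substitution becomes `M · R ⟶ M · S ⟶ M`. -/
@[simps]
def pullback {R S : SetMonad.{u}} (f : R ⟶ S) : MonadModule S ⥤ MonadModule R where
  obj M :=
    { functor := M.functor
      act :=
        { app := fun X => M.functor.map (f.app X) ≫ M.act.app X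
          naturality := fun X Y g => by
            have h := M.act.naturality g
            have hf := f.naturality g
            simp only [Functor.comp_map] at h ⊢
            rw [← Category.assoc, ← M.functor.map_comp, hf, M.functor.map_comp, Category.assoc, h,
              Category.assoc] }
      act_act := fun X => by
        have h1 := M.act_act X
        have h2 := M.act.naturality (f.app X)
        have h3 := f.app_μ X
        simp only [Functor.comp_map] at h2
        simp only [Category.assoc]
        rw [← Category.assoc (M.act.app _), ← h2, Category.assoc, h1, ← Category.assoc (M.functor.map (R.μ.app X)),
          ← M.functor.map_comp, h3]
        simp only [Functor.map_comp, ← Category.assoc]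
        congr 2
        rw [← Functor.map_comp, ← Functor.map_comp, f.naturality]
      act_unit := fun X => by
        have h := M.act_unit X
        rw [← Category.assoc, ← M.functor.map_comp, f.app_η, h] }
  map {M N} m :=
    { nat := m.nat
      linear := fun X => by
        have h := m.linear X
        have h' := m.nat.naturality (f.app X)
        dsimp only
        rw [Category.assoc, h, ← Category.assoc, h', Category.assoc] }

/-- The product of a family of modules over the same monad, computed pointwise; the product of the
empty family is the final module. -/
@[simps]
def pi {R : SetMonad.{u}} {n : ℕ} (M : Fin n → MonadModule R) : MonadModule R where
  functor :=
    { obj := fun X => ∀ i, (M i).functor.obj X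
      map := fun f => ↾fun x i => (M i).functor.map f (x i) }
  act :=
    { app := fun X => ↾fun x i => (M i).act.app X (x i)
      naturality := fun X Y f => by
        ext x i
        exact ConcreteCategory.congr_hom ((M i).act.naturality f) (x i) }
  act_act X := by
    ext x i
    exact ConcreteCategory.congr_hom ((M i).act_act X) (x i)
  act_unit X := by
    ext x i
    exact ConcreteCategory.congr_hom ((M i).act_unit X) (x i)

end MonadModule

/-! ### The total category of modules -/

/-- Objects of the total module category `∫Mod`: pairs of a monad and a module over it. -/
structure TotalModule where
  base : SetMonad.{u}
  fiber : MonadModule base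

namespace TotalModule

/-- A morphism `(R, M) ⟶ (S, N)` of `∫Mod`: a monad morphism `f : R ⟶ S` and a module morphism
`M ⟶ f^* N`. -/
structure Hom (A B : TotalModule.{u}) where
  base : A.base ⟶ B.base
  fiber : A.fiber ⟶ (MonadModule.pullback base).obj B.fiber

theorem Hom.ext' {A B : TotalModule.{u}} {f g : Hom A B} (h : f.base = g.base)
    (h' : (f.fiber.nat : A.fiber.functor ⟶ B.fiber.functor) = g.fiber.nat) : f = g := by
  obtain ⟨f, m⟩ := f
  obtain ⟨g, n⟩ := g
  obtain rfl : f = g := h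
  obtain rfl : m = n := MonadModule.hom_ext _ _ h'
  rfl

instance category : Category TotalModule.{u} where
  Hom := Hom
  id A :=
    { base := 𝟙 A.base
      fiber :=
        { nat := 𝟙 A.fiber.functor
          linear := fun X => by
            have h : A.fiber.act.app X = A.fiber.functor.map (𝟙 _) ≫ A.fiber.act.app X := by simp
            exact (Category.comp_id _).trans (h.trans (Category.id_comp _).symm) } }
  comp {A B C} f g :=
    { base := f.base ≫ g.base
      fiber :=
        { nat := (f.fiber.nat : A.fiber.functor ⟶ B.fiber.functor) ≫ g.fiber.nat
          linear := fun X => by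
            have h : C.fiber.functor.map (f.base.app X) ≫ C.fiber.functor.map (g.base.app X) ≫
                C.fiber.act.app X =
                C.fiber.functor.map (f.base.app X ≫ g.base.app X) ≫ C.fiber.act.app X := by simp
            exact ((f.fiber ≫ (MonadModule.pullback f.base).map g.fiber).linear X).trans
              (congrArg (fun t => _ ≫ t) h) } }
  id_comp f := Hom.ext' (Category.id_comp _) (Category.id_comp _)
  comp_id f := Hom.ext' (Category.comp_id _) (Category.comp_id _)
  assoc f g h := Hom.ext' (Category.assoc _ _ _) (Category.assoc _ _ _)

/-- The forgetful functor `∫Mod ⥤ Mon`. -/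
def forget : TotalModule.{u} ⥤ SetMonad.{u} where
  obj A := A.base
  map f := f.base

end TotalModule

/-! ### Signatures -/

/-- A signature: a section of the forgetful functor `∫Mod ⥤ Mon`. It sends a monad `R` to an
`R`-module `Σ(R)` and a monad morphism `f : R ⟶ S` to a morphism of `R`-modules
`Σ(R) ⟶ f^* Σ(S)`, functorially; see `Signature.toFunctor` and `Signature.toFunctor_forget`. -/
structure Signature where
  obj (R : SetMonad.{u}) : MonadModule R
  map {R S : SetMonad.{u}} (f : R ⟶ S) : obj R ⟶ (MonadModule.pullback f).obj (obj S)
  map_id (R : SetMonad.{u}) : (map (𝟙 R)).nat = 𝟙 (obj R).functor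
  map_comp {R S T : SetMonad.{u}} (f : R ⟶ S) (g : S ⟶ T) :
    (map (f ≫ g)).nat =
      ((map f).nat : (obj R).functor ⟶ (obj S).functor) ≫ (map g).nat

namespace Signature

/-- A signature as a functor `Mon ⥤ ∫Mod`. -/
def toFunctor (A : Signature.{u}) : SetMonad.{u} ⥤ TotalModule.{u} where
  obj R := ⟨R, A.obj R⟩
  map f := ⟨f, A.map f⟩
  map_id R := TotalModule.Hom.ext' rfl (A.map_id R)
  map_comp f g := TotalModule.Hom.ext' rfl (A.map_comp f g)

theorem toFunctor_forget (A : Signature.{u}) : A.toFunctor ⋙ TotalModule.forget = 𝟭 _ := rfl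

/-- A morphism of signatures: module morphisms `A(R) ⟶ B(R)`, natural in the monad `R`, that is,
a natural transformation between functors `Mon ⥤ ∫Mod` lying over the identity of `Mon`. -/
@[ext]
structure Hom (A B : Signature.{u}) where
  app (R : SetMonad.{u}) : A.obj R ⟶ B.obj R
  naturality {R S : SetMonad.{u}} (f : R ⟶ S) :
    A.map f ≫ (MonadModule.pullback f).map (app S) = app R ≫ B.map f

/-- The category `Sig` of signatures. -/
instance category : Category Signature.{u} where
  Hom := Hom
  id A :=
    { app := fun R => 𝟙 (A.obj R)
      naturality := fun f => by
        rw [CategoryTheory.Functor.map_id, Category.comp_id, Category.id_comp] }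
  comp m n :=
    { app := fun R => m.app R ≫ n.app R
      naturality := fun f => by
        rw [Functor.map_comp, ← Category.assoc, m.naturality, Category.assoc, n.naturality,
          Category.assoc] }

@[ext]
theorem hom_ext {A B : Signature.{u}} (m n : A ⟶ B) (h : ∀ R, m.app R = n.app R) : m = n :=
  Hom.ext (funext h)

@[simp]
theorem id_app (A : Signature.{u}) (R : SetMonad.{u}) : Hom.app (𝟙 A) R = 𝟙 (A.obj R) := rfl

@[simp]
theorem comp_app {A B C : Signature.{u}} (m : A ⟶ B) (n : B ⟶ C) (R : SetMonad.{u}) :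
    Hom.app (m ≫ n) R = m.app R ≫ n.app R := rfl

/-- The signature `Θ : R ↦ R`. -/
def theta : Signature.{u} where
  obj R := MonadModule.tautological R
  map {R S} f :=
    { nat := f.toNatTrans
      linear := fun X => by
        have h : R.μ.app X ≫ f.app X = f.app (R.obj X) ≫ S.map (f.app X) ≫ S.μ.app X := by
          rw [f.app_μ, f.naturality, Category.assoc]
        exact h }
  map_id _ := rfl
  map_comp _ _ := rfl

end Signature

/-! ### Derivation -/

/-- The functor `X ↦ X + *`. -/
@[simps]
def addPoint : Type u ⥤ Type u where
  obj X := Option X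
  map f := ↾Option.map f
  map_id X := by ext x; cases x <;> rfl
  map_comp f g := by ext x; cases x <;> rfl

/-- The inclusion `X ⟶ X + *`. -/
def addPointIncl (X : Type u) : X ⟶ addPoint.obj X := ↾(some : X → Option X)

theorem addPointIncl_naturality {X Y : Type u} (f : X ⟶ Y) :
    addPointIncl X ≫ addPoint.map f = f ≫ addPointIncl Y := rfl

/-- The map `R(X) + * ⟶ R(X + *)` given by `R` of the inclusion `X ⟶ X + *` and by the unit at the
added point. -/
def addPointDist (R : SetMonad.{u}) (X : Type u) :
    addPoint.obj (R.obj X) ⟶ R.obj (addPoint.obj X) :=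
  ↾fun t : Option (R.obj X) =>
    t.elim (R.η.app (addPoint.obj X) (none : Option X)) (R.map (addPointIncl X))

theorem addPointIncl_dist (R : SetMonad.{u}) (X : Type u) :
    addPointIncl (R.obj X) ≫ addPointDist R X = R.map (addPointIncl X) := rfl

theorem addPoint_hom_ext {X Y : Type u} {f g : addPoint.obj X ⟶ Y}
    (h : addPointIncl X ≫ f = addPointIncl X ≫ g)
    (h' : f (none : Option X) = g (none : Option X)) : f = g := by
  ext t
  cases (t : Option X) with
  | none => exact h'
  | some a => exact ConcreteCategory.congr_hom h a

theorem addPointDist_naturality (R : SetMonad.{u}) {X Y : Type u} (f : X ⟶ Y) :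
    addPoint.map (R.map f) ≫ addPointDist R Y = addPointDist R X ≫ R.map (addPoint.map f) := by
  apply addPoint_hom_ext
  · rw [← Category.assoc, addPointIncl_naturality, Category.assoc, addPointIncl_dist,
      ← Category.assoc, addPointIncl_dist, ← R.map_comp, ← R.map_comp, addPointIncl_naturality]
  · exact ConcreteCategory.congr_hom (R.η.naturality (addPoint.map f)) (none : Option X)

theorem addPointDist_unit (R : SetMonad.{u}) (X : Type u) :
    addPoint.map (R.η.app X) ≫ addPointDist R X = R.η.app (addPoint.obj X) := by
  apply addPoint_hom_ext
  · exact (R.η.naturality (addPointIncl X)).symm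
  · rfl

theorem addPointDist_hom {R S : SetMonad.{u}} (f : R ⟶ S) (X : Type u) :
    addPoint.map (f.app X) ≫ addPointDist S X = addPointDist R X ≫ f.app (addPoint.obj X) := by
  apply addPoint_hom_ext
  · rw [← Category.assoc, addPointIncl_naturality, Category.assoc, addPointIncl_dist,
      ← Category.assoc, addPointIncl_dist, f.naturality]
  · exact (ConcreteCategory.congr_hom (f.app_η (addPoint.obj X)) (none : Option X)).symm

theorem addPointDist_mul (R : SetMonad.{u}) (X : Type u) :
    addPoint.map (R.μ.app X) ≫ addPointDist R X =
      addPointDist R (R.obj X) ≫ R.map (addPointDist R X) ≫ R.μ.app (addPoint.obj X) := by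
  apply addPoint_hom_ext
  · have h : R.μ.app X ≫ R.map (addPointIncl X) =
        R.map (addPointIncl (R.obj X)) ≫ R.map (addPointDist R X) ≫
          R.μ.app (addPoint.obj X) := by
      rw [← R.mu_naturality, ← Category.assoc, ← R.map_comp, addPointIncl_dist]
    exact h
  · have h : R.η.app (addPoint.obj (R.obj X)) ≫ R.map (addPointDist R X) ≫
        R.μ.app (addPoint.obj X) = addPointDist R X := by
      rw [← Category.assoc, ← R.unit_naturality, Category.assoc, R.left_unit]
      rfl
    exact (ConcreteCategory.congr_hom h (none : Option (R.obj X))).symm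

/-- The derivative `M'` of a module: `M'(X) = M(X + *)`, with substitution
`M(R(X) + *) ⟶ M(R(X + *)) ⟶ M(X + *)`. -/
def MonadModule.deriv {R : SetMonad.{u}} (M : MonadModule R) : MonadModule R where
  functor := addPoint ⋙ M.functor
  act :=
    { app := fun X => M.functor.map (addPointDist R X) ≫ M.act.app (addPoint.obj X)
      naturality := fun X Y f => by
        have h : M.functor.map (R.map (addPoint.map f)) ≫ M.act.app _ =
          M.act.app _ ≫ M.functor.map (addPoint.map f) := M.act.naturality (addPoint.map f)
        dsimp only [Functor.comp_map, Functor.comp_obj]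
        rw [← Category.assoc, ← M.functor.map_comp, addPointDist_naturality, M.functor.map_comp,
          Category.assoc, h, Category.assoc] }
  act_act X := by
    have h : M.functor.map (R.map (addPointDist R X)) ≫ M.act.app _ =
      M.act.app _ ≫ M.functor.map (addPointDist R X) := M.act.naturality (addPointDist R X)
    dsimp only [Functor.comp_map, Functor.comp_obj]
    rw [← Category.assoc (M.functor.map (addPoint.map _)), ← M.functor.map_comp, addPointDist_mul,
      Category.assoc, ← Category.assoc (M.act.app _) (M.functor.map _), ← h, Category.assoc,
      M.act_act]
    simp only [Functor.map_comp, Category.assoc]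
  act_unit X := by
    dsimp only [Functor.comp_map, Functor.comp_obj]
    rw [← Category.assoc, ← M.functor.map_comp, addPointDist_unit, M.act_unit]

namespace Signature

/-- The derivative of a signature, `R ↦ Σ(R)'`. -/
def deriv (A : Signature.{u}) : Signature.{u} where
  obj R := (A.obj R).deriv
  map {R S} f :=
    { nat := Functor.whiskerLeft addPoint (A.map f).nat
      linear := fun X => by
        have h := (A.map f).linear (addPoint.obj X)
        have h' := (A.map f).nat.naturality (addPointDist R X)
        dsimp only [MonadModule.deriv, MonadModule.pullback, Functor.whiskerLeft_app,
          Functor.comp_obj, Functor.comp_map] at h h' ⊢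
        rw [Category.assoc, h, ← Category.assoc, h', Category.assoc,
          ← Category.assoc ((A.obj S).functor.map _), ← Category.assoc ((A.obj S).functor.map _),
          ← Functor.map_comp, ← Functor.map_comp, addPointDist_hom] }
  map_id R := congrArg (Functor.whiskerLeft addPoint) (A.map_id R)
  map_comp f g := congrArg (Functor.whiskerLeft addPoint) (A.map_comp f g)

/-- The iterated derivative `R ↦ Σ(R)^(k)`. -/
def iterDeriv (A : Signature.{u}) : ℕ → Signature.{u}
  | 0 => A
  | k + 1 => (A.iterDeriv k).deriv

/-- The product of a finite family of signatures, `R ↦ ∏ i, Σᵢ(R)`. -/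
def pi {n : ℕ} (A : Fin n → Signature.{u}) : Signature.{u} where
  obj R := MonadModule.pi fun i => (A i).obj R
  map f :=
    { nat :=
        { app := fun X => ↾fun x i => ((A i).map f).nat.app X (x i)
          naturality := fun X Y g => by
            ext x
            exact funext fun i =>
              ConcreteCategory.congr_hom (((A i).map f).nat.naturality g) (x i) }
      linear := fun X => by
        ext x
        exact funext fun i => ConcreteCategory.congr_hom (((A i).map f).linear X) (x i) }
  map_id R := by
    ext X x
    exact funext fun i =>
      ConcreteCategory.congr_hom (NatTrans.congr_app ((A i).map_id R) X) (x i)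
  map_comp f g := by
    ext X x
    exact funext fun i =>
      ConcreteCategory.congr_hom (NatTrans.congr_app ((A i).map_comp f g) X) (x i)

/-- The elementary signature `R ↦ R^(s₁) × ⋯ × R^(sₙ)`. -/
def elementary (s : List ℕ) : Signature.{u} :=
  pi fun i : Fin s.length => theta.iterDeriv (s.get i)

/-- An algebraic signature is a (possibly infinite) coproduct, in the category of signatures, of
elementary signatures. -/
def IsAlgebraic (A : Signature.{u}) : Prop :=
  ∃ (I : Type u) (s : I → List ℕ) (ι : ∀ i, elementary (s i) ⟶ A),
    Nonempty (IsColimit (Cofan.mk A ι))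

/-! ### Models -/

/-- A model of a signature: a monad `R` with a module morphism `Σ(R) ⟶ R`. -/
structure Model (A : Signature.{u}) where
  monad : SetMonad.{u}
  action : A.obj monad ⟶ MonadModule.tautological monad

namespace Model

/-- A morphism of models: a monad morphism `m : R ⟶ S` such that the square of `R`-modules with
sides `Σ(R) ⟶ R ⟶ m^* S` and `Σ(R) ⟶ m^* Σ(S) ⟶ m^* S` commutes. -/
@[ext]
structure Hom {A : Signature.{u}} (M N : A.Model) where
  hom : M.monad ⟶ N.monad
  comm : M.action ≫ theta.map hom = A.map hom ≫ (MonadModule.pullback hom).map N.action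

/-- The category of models of a signature. -/
instance category (A : Signature.{u}) : Category A.Model where
  Hom M N := Hom M N
  id M :=
    { hom := 𝟙 M.monad
      comm := by
        apply MonadModule.hom_ext
        exact (Category.comp_id _).trans ((Category.id_comp _).symm.trans
          (congrArg (· ≫ M.action.nat) (A.map_id M.monad).symm)) }
  comp {L M N} f g :=
    { hom := f.hom ≫ g.hom
      comm := by
        have hf := congrArg MonadModule.Hom.nat f.comm
        have hg := congrArg MonadModule.Hom.nat g.comm
        apply MonadModule.hom_ext
        ext X : 2
        have hf' := NatTrans.congr_app hf X
        have hg' := NatTrans.congr_app hg X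
        have h := NatTrans.congr_app (A.map_comp f.hom g.hom) X
        change L.action.nat.app X ≫ f.hom.app X = (A.map f.hom).nat.app X ≫ M.action.nat.app X
          at hf'
        change M.action.nat.app X ≫ g.hom.app X = (A.map g.hom).nat.app X ≫ N.action.nat.app X
          at hg'
        change (A.map (f.hom ≫ g.hom)).nat.app X =
          (A.map f.hom).nat.app X ≫ (A.map g.hom).nat.app X at h
        change L.action.nat.app X ≫ f.hom.app X ≫ g.hom.app X =
          (A.map (f.hom ≫ g.hom)).nat.app X ≫ N.action.nat.app X
        calc L.action.nat.app X ≫ f.hom.app X ≫ g.hom.app X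
            = ((A.map f.hom).nat.app X ≫ M.action.nat.app X) ≫ g.hom.app X :=
              (Category.assoc _ _ _).symm.trans (congrArg (· ≫ g.hom.app X) hf')
          _ = (A.map f.hom).nat.app X ≫ (A.map g.hom).nat.app X ≫ N.action.nat.app X :=
              (Category.assoc _ _ _).trans (congrArg ((A.map f.hom).nat.app X ≫ ·) hg')
          _ = (A.map (f.hom ≫ g.hom)).nat.app X ≫ N.action.nat.app X :=
              (Category.assoc _ _ _).symm.trans (congrArg (· ≫ N.action.nat.app X) h.symm) }
  id_comp f := Hom.ext (Category.id_comp f.hom)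
  comp_id f := Hom.ext (Category.comp_id f.hom)
  assoc f g h := Hom.ext (Category.assoc f.hom g.hom h.hom)

end Model

/-- A signature is representable if its category of models has an initial object. -/
def IsRepresentable (A : Signature.{u}) : Prop :=
  HasInitial A.Model

end Signature

/-!
A family that assigns to every model of `B` an element of it over `X` is *definable* if it is
generated by the variables and the operations that elementary signatures induce through their
morphisms to `B`. Families indexed by all models form a proper class, but every definable one is
named by a syntactic term, so the definable ones form a set. They are closed under substitution,
hence form a monad. If the elementary signatures jointly cover `B`, then `B` acts on this monad,
componentwise. Evaluation at `S` is then a morphism of models to `S`, and it is the only one because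
morphisms of models preserve definable families.

The legs of a colimit of signatures are jointly surjective: their joint range is a subsignature
through which the identity factors. So a colimit of signatures covered by sets of elementary
signatures is again covered by a set of elementary signatures.
-/

/-! ### Substitution -/

/-- The unit of a monad on sets, as a function into the terms over `X`. -/
def SetMonad.unit (R : SetMonad.{u}) {X : Type u} (x : X) : R.obj X :=
  R.η.app X x

namespace MonadModule

variable {R S : SetMonad.{u}}

/-- Simultaneous substitution in a module: the action of `R` on `M` in Kleisli form. -/
def subst (M : MonadModule R) {X Y : Type u} (f : X → R.obj Y) (t : M.functor.obj X) :
    M.functor.obj Y :=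
  M.act.app Y (M.functor.map (↾f) t)

theorem act_eq_subst (M : MonadModule R) {X : Type u} (t : M.functor.obj (R.obj X)) :
    M.act.app X t = M.subst id t :=
  congrArg (M.act.app X) (M.functor.map_id_apply _ t).symm

theorem subst_unit (M : MonadModule R) {X : Type u} (t : M.functor.obj X) :
    M.subst R.unit t = t :=
  ConcreteCategory.congr_hom (M.act_unit X) t

theorem subst_map (M : MonadModule R) {X Y Z : Type u} (g : X ⟶ Y) (f : Y → R.obj Z)
    (t : M.functor.obj X) : M.subst f (M.functor.map g t) = M.subst (fun x => f (g x)) t :=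
  congrArg (M.act.app Z) (M.functor.map_comp_apply g (↾f) t).symm

theorem map_eq_subst (M : MonadModule R) {X Y : Type u} (g : X ⟶ Y) (t : M.functor.obj X) :
    M.functor.map g t = M.subst (fun x => R.unit (g x)) t := by
  rw [← M.subst_map g R.unit, M.subst_unit]

end MonadModule

/-- Substitution of terms in terms: the Kleisli extension of `f`. -/
abbrev SetMonad.bind (R : SetMonad.{u}) {X Y : Type u} (f : X → R.obj Y) (t : R.obj X) :
    R.obj Y :=
  (MonadModule.tautological R).subst f t

namespace MonadModule

variable {R S : SetMonad.{u}}

theorem subst_subst (M : MonadModule R) {X Y Z : Type u} (f : X → R.obj Y) (g : Y → R.obj Z)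
    (t : M.functor.obj X) :
    M.subst g (M.subst f t) = M.subst (fun x => R.bind g (f x)) t := by
  have h : (M.functor.map (↾f) ≫ M.act.app Y) ≫ M.functor.map (↾g) ≫ M.act.app Z =
      M.functor.map (↾f ≫ R.map (↾g) ≫ R.μ.app Z) ≫ M.act.app Z := by
    have hnat : M.act.app Y ≫ M.functor.map (↾g) =
      M.functor.map (R.map (↾g)) ≫ M.act.app (R.obj Z) := (M.act.naturality (↾g)).symm
    simp only [Functor.map_comp, Category.assoc, reassoc_of% hnat, M.act_act]
  exact ConcreteCategory.congr_hom h t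

theorem Hom.app_subst {M N : MonadModule R} (m : M ⟶ N) {X Y : Type u} (f : X → R.obj Y)
    (t : M.functor.obj X) :
    m.nat.app Y (M.subst f t) = N.subst f (m.nat.app X t) :=
  (ConcreteCategory.congr_hom (m.linear Y) _).trans
    (congrArg (N.act.app Y) (NatTrans.naturality_apply m.nat (↾f) t))

theorem pullback_subst (f : R ⟶ S) (N : MonadModule S) {X Y : Type u} (g : X → R.obj Y)
    (t : N.functor.obj X) :
    ((pullback f).obj N).subst g t = N.subst (fun x => f.app Y (g x)) t :=
  N.subst_map (↾g) (f.app Y) t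

theorem Hom.app_subst_pullback {f : R ⟶ S} {M : MonadModule R} {N : MonadModule S}
    (m : M ⟶ (pullback f).obj N) {X Y : Type u} (g : X → R.obj Y) (t : M.functor.obj X) :
    m.nat.app Y (M.subst g t) = N.subst (fun x => f.app Y (g x)) (m.nat.app X t) :=
  (m.app_subst g t).trans (pullback_subst f N g _)

/-- A family of functions commuting with substitution, as a morphism of modules. -/
def homOfSubst {M N : MonadModule R} (φ : ∀ X : Type u, M.functor.obj X → N.functor.obj X)
    (hφ : ∀ {X Y : Type u} (f : X → R.obj Y) (t : M.functor.obj X),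
      φ Y (M.subst f t) = N.subst f (φ X t)) : M ⟶ N where
  nat :=
    { app X := ↾φ X
      naturality X Y g := by
        ext t
        change φ Y (M.functor.map g t) = N.functor.map g (φ X t)
        rw [map_eq_subst, map_eq_subst, hφ] }
  linear X := by
    ext t
    change φ X (M.act.app X t) = N.act.app X (φ (R.obj X) t)
    rw [act_eq_subst, act_eq_subst, hφ]

end MonadModule

namespace SetMonad

open MonadModule

variable {R S : SetMonad.{u}}

theorem bind_unit (R : SetMonad.{u}) {X Y : Type u} (f : X → R.obj Y) (x : X) :
    R.bind f (R.unit x) = f x :=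
  (congrArg (R.μ.app Y) (NatTrans.naturality_apply R.η (↾f) x).symm).trans
    (ConcreteCategory.congr_hom (R.left_unit Y) (f x))

theorem hom_ext {f g : R ⟶ S} (h : ∀ X (t : R.obj X), f.app X t = g.app X t) : f = g :=
  MonadHom.ext' _ _ (funext fun X => by ext t; exact h X t)

theorem hom_unit (f : R ⟶ S) {X : Type u} (x : X) : f.app X (R.unit x) = S.unit x :=
  ConcreteCategory.congr_hom (f.app_η X) x

theorem hom_bind (f : R ⟶ S) {X Y : Type u} (g : X → R.obj Y) (t : R.obj X) :
    f.app Y (R.bind g t) = S.bind (fun x => f.app Y (g x)) (f.app X t) :=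
  Hom.app_subst_pullback (N := tautological S) (Signature.theta.map f) g t

/-- A family of functions commuting with units and substitution, as a morphism of monads. -/
def homOfBind (φ : ∀ X : Type u, R.obj X → S.obj X)
    (hunit : ∀ {X : Type u} (x : X), φ X (R.unit x) = S.unit x)
    (hbind : ∀ {X Y : Type u} (f : X → R.obj Y) (t : R.obj X),
      φ Y (R.bind f t) = S.bind (fun x => φ Y (f x)) (φ X t)) : R ⟶ S :=
  have hmap {X Y : Type u} (g : X ⟶ Y) (t : R.obj X) : φ Y (R.map g t) = S.map g (φ X t) := by
    rw [(tautological R).map_eq_subst, (tautological S).map_eq_subst, hbind]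
    simp only [hunit]
  { app X := ↾φ X
    naturality X Y g := by ext t; exact hmap g t
    app_η X := by ext x; exact hunit x
    app_μ X := by
      ext t
      change φ X (R.μ.app X t) = S.μ.app X (φ (S.obj X) (R.map (↾φ X) t))
      rw [hmap, (tautological R).act_eq_subst, hbind]
      rfl }

theorem bind_ofTypeMonad (m : Type u → Type u) [_root_.Monad m] [LawfulMonad m] {X Y : Type u}
    (f : X → m Y) (t : m X) : SetMonad.bind (ofTypeMonad m) f t = t >>= f :=
  bind_map_left f t id

/-- The extension of a substitution under a binder: the bound variable is left alone. -/
def lift (R : SetMonad.{u}) {X Y : Type u} (f : X → R.obj Y) : Option X → R.obj (Option Y) :=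
  fun x => x.elim (R.unit none) fun x => R.map (addPointIncl Y) (f x)

/-- The extension of a substitution under `m` binders. -/
def iterLift (R : SetMonad.{u}) : (m : ℕ) → {X Y : Type u} → (X → R.obj Y) →
    Option^[m] X → R.obj (Option^[m] Y)
  | 0, _, _, f => f
  | m + 1, _, _, f => R.iterLift m (R.lift f)

end SetMonad

/-! ### Elementary signatures and their models -/

theorem MonadModule.deriv_subst {R : SetMonad.{u}} (M : MonadModule R) {X Y : Type u}
    (f : X → R.obj Y) (t : M.deriv.functor.obj X) :
    M.deriv.subst f t = M.subst (R.lift f) t := by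
  have hlift : addPoint.map (↾f) ≫ addPointDist R Y = ↾R.lift f := by
    apply addPoint_hom_ext <;> rfl
  refine (M.subst_map (addPoint.map (↾f)) (addPointDist R Y) t).trans ?_
  exact congrArg (fun g : Option X ⟶ R.obj (Option Y) => M.subst g t) hlift

namespace Signature

theorem naturality_apply {A B : Signature.{u}} (m : A ⟶ B) {R S : SetMonad.{u}} (f : R ⟶ S)
    {X : Type u} (a : (A.obj R).functor.obj X) :
    (m.app S).nat.app X ((A.map f).nat.app X a) = (B.map f).nat.app X ((m.app R).nat.app X a) :=
  ConcreteCategory.congr_hom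
    (NatTrans.congr_app (congrArg MonadModule.Hom.nat (m.naturality f)) X) a

/-- The elements of the `m`-th derivative over `X` are those of the signature over `X` with `m`
points added. The two types are equal, but only propositionally so for variable `m`. -/
def iterDerivEquiv (A : Signature.{u}) (R : SetMonad.{u}) : (m : ℕ) → (X : Type u) →
    ((A.iterDeriv m).obj R).functor.obj X ≃ (A.obj R).functor.obj (Option^[m] X)
  | 0, _ => Equiv.refl _
  | m + 1, X => iterDerivEquiv A R m (Option X)

theorem iterDerivEquiv_subst (A : Signature.{u}) (R : SetMonad.{u}) (m : ℕ) {X Y : Type u}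
    (f : X → R.obj Y) (t : ((A.iterDeriv m).obj R).functor.obj X) :
    iterDerivEquiv A R m Y (((A.iterDeriv m).obj R).subst f t) =
      (A.obj R).subst (R.iterLift m f) (iterDerivEquiv A R m X t) := by
  induction m generalizing X Y with
  | zero => rfl
  | succ m ih =>
    exact (congrArg (iterDerivEquiv A R m (Option Y)) (MonadModule.deriv_subst _ f t)).trans
      (ih (R.lift f) t)

theorem iterDerivEquiv_map (A : Signature.{u}) {R S : SetMonad.{u}} (f : R ⟶ S) (m : ℕ)
    {X : Type u} (t : ((A.iterDeriv m).obj R).functor.obj X) :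
    iterDerivEquiv A S m X (((A.iterDeriv m).map f).nat.app X t) =
      (A.map f).nat.app _ (iterDerivEquiv A R m X t) := by
  induction m generalizing X with
  | zero => rfl
  | succ m ih => exact ih (X := Option X) t

/-- The argument tuples of an operation of arity `s` on the monad `R`, over the variables `X`: the
`i`-th argument has `s i` extra bound variables. -/
abbrev Args (R : SetMonad.{u}) (s : List ℕ) (X : Type u) : Type u :=
  ∀ i : Fin s.length, R.obj (Option^[s.get i] X)

/-- The elements of an elementary module are argument tuples. -/
def elementaryEquiv (R : SetMonad.{u}) (s : List ℕ) (X : Type u) :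
    ((elementary s).obj R).functor.obj X ≃ Args R s X :=
  Equiv.piCongrRight fun i => iterDerivEquiv theta R (s.get i) X

theorem elementaryEquiv_subst (R : SetMonad.{u}) (s : List ℕ) {X Y : Type u} (f : X → R.obj Y)
    (t : ((elementary s).obj R).functor.obj X) :
    elementaryEquiv R s Y (((elementary s).obj R).subst f t) =
      fun i => R.bind (R.iterLift (s.get i) f) (elementaryEquiv R s X t i) :=
  funext fun i => iterDerivEquiv_subst theta R (s.get i) f (t i)

theorem elementaryEquiv_map {R S : SetMonad.{u}} (f : R ⟶ S) (s : List ℕ) {X : Type u}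
    (t : ((elementary s).obj R).functor.obj X) :
    elementaryEquiv S s X (((elementary s).map f).nat.app X t) =
      fun i => f.app _ (elementaryEquiv R s X t i) :=
  funext fun i => iterDerivEquiv_map theta f (s.get i) (t i)

namespace Model

theorem hom_action {A : Signature.{u}} {M N : A.Model} (f : M ⟶ N) {X : Type u}
    (a : (A.obj M.monad).functor.obj X) :
    f.hom.app X (M.action.nat.app X a) = N.action.nat.app X ((A.map f.hom).nat.app X a) :=
  ConcreteCategory.congr_hom (NatTrans.congr_app (congrArg MonadModule.Hom.nat f.comm) X) a

/-- Restriction of models along a morphism of signatures. -/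
def restrict {A B : Signature.{u}} (m : A ⟶ B) : B.Model ⥤ A.Model where
  obj S := ⟨S.monad, m.app S.monad ≫ S.action⟩
  map {M N} f :=
    { hom := f.hom
      comm := by
        ext X a
        exact (hom_action f _).trans
          (congrArg (N.action.nat.app X) (naturality_apply m f.hom a).symm) }

variable {s : List ℕ}

/-- The operation on argument tuples given by a model of an elementary signature. -/
def op (S : (elementary s).Model) {X : Type u} (a : Args S.monad s X) : S.monad.obj X :=
  S.action.nat.app X ((elementaryEquiv S.monad s X).symm a)

theorem op_elementaryEquiv (S : (elementary s).Model) {X : Type u}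
    (t : ((elementary s).obj S.monad).functor.obj X) :
    S.op (elementaryEquiv S.monad s X t) = S.action.nat.app X t := by
  rw [op, Equiv.symm_apply_apply]

theorem bind_op (S : (elementary s).Model) {X Y : Type u} (f : X → S.monad.obj Y)
    (a : Args S.monad s X) :
    S.monad.bind f (S.op a) =
      S.op fun i => S.monad.bind (S.monad.iterLift (s.get i) f) (a i) := by
  obtain ⟨t, rfl⟩ := (elementaryEquiv S.monad s X).surjective a
  rw [op_elementaryEquiv, ← elementaryEquiv_subst, op_elementaryEquiv,
    MonadModule.Hom.app_subst]

theorem action_map {R : SetMonad.{u}} (S : (elementary s).Model) (f : R ⟶ S.monad) {X : Type u}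
    (t : ((elementary s).obj R).functor.obj X) :
    S.action.nat.app X (((elementary s).map f).nat.app X t) =
      S.op fun i => f.app _ (elementaryEquiv R s X t i) := by
  rw [← elementaryEquiv_map]
  exact (S.op_elementaryEquiv _).symm

theorem hom_op {M N : (elementary s).Model} (f : M ⟶ N) {X : Type u} (a : Args M.monad s X) :
    f.hom.app X (M.op a) = N.op fun i => f.hom.app _ (a i) := by
  obtain ⟨t, rfl⟩ := (elementaryEquiv M.monad s X).surjective a
  rw [op_elementaryEquiv]
  exact (hom_action f t).trans (N.action_map f.hom t)

end Model

/-! ### Definable families -/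

section Definable

variable {B : Signature.{u}} {K : Type u} {s : K → List ℕ} (e : ∀ k, elementary (s k) ⟶ B)

/-- A family of elements of all models of `B` is definable if it is generated by the variables and
by the operations that the morphisms `e k` induce on every model. -/
inductive Definable : (X : Type u) → (∀ S : B.Model, S.monad.obj X) → Prop
  | var {X : Type u} (x : X) : Definable X fun S => S.monad.unit x
  | op {X : Type u} (k : K) (z : ∀ i (S : B.Model), S.monad.obj (Option^[(s k).get i] X))
      (h : ∀ i, Definable _ (z i)) :
      Definable X fun S => ((Model.restrict (e k)).obj S).op fun i => z i S

/-- A class of families of elements of all models of `B` that contains the variables and is closed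
under the inclusions `X ⟶ X + *`, so that it is stable under lifting of substitutions. Substitution
is studied first for the class of variables, which shows that the definable families are such a
class, and then for that class. -/
structure ClosedUnderWeakening (C : ∀ Y : Type u, (∀ S : B.Model, S.monad.obj Y) → Prop) :
    Prop where
  unit {Y : Type u} (y : Y) : C Y fun S => S.monad.unit y
  weaken {Y : Type u} {z : ∀ S : B.Model, S.monad.obj Y} :
    C Y z → C (Option Y) fun S => S.monad.map (addPointIncl Y) (z S)

namespace ClosedUnderWeakening

variable {C : ∀ Y : Type u, (∀ S : B.Model, S.monad.obj Y) → Prop} {X Y : Type u}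
  {f : ∀ S : B.Model, X → S.monad.obj Y}

theorem lift (hC : ClosedUnderWeakening C) (hf : ∀ x, C Y fun S => f S x) (x : Option X) :
    C (Option Y) fun S => S.monad.lift (f S) x :=
  match x with
  | none => hC.unit none
  | some x => hC.weaken (hf x)

theorem iterLift (hC : ClosedUnderWeakening C) (m : ℕ) (hf : ∀ x, C Y fun S => f S x)
    (x : Option^[m] X) : C (Option^[m] Y) fun S => S.monad.iterLift m (f S) x := by
  induction m generalizing X Y with
  | zero => exact hf x
  | succ m ih => exact ih (hC.lift hf) x

end ClosedUnderWeakening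

namespace Definable

variable {e} {X Y : Type u} {f : ∀ S : B.Model, X → S.monad.obj Y}
  {z : ∀ S : B.Model, S.monad.obj X}

theorem bind_of_closedUnderWeakening {C : ∀ Y : Type u, (∀ S : B.Model, S.monad.obj Y) → Prop}
    (hC : ClosedUnderWeakening C) (hCe : ∀ {Y z}, C Y z → Definable e Y z)
    (hf : ∀ x, C Y fun S => f S x) (hz : Definable e X z) :
    Definable e Y fun S => S.monad.bind (f S) (z S) := by
  induction hz generalizing Y with
  | var x =>
    simp only [SetMonad.bind_unit]
    exact hCe (hf x)
  | op k z _ ih =>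
    have h := funext fun S => ((Model.restrict (e k)).obj S).bind_op (f S) fun i => z i S
    exact (congrArg (Definable e Y) h).mpr (op k _ fun i => ih i (hC.iterLift _ hf))

theorem weaken (hz : Definable e X z) :
    Definable e (Option X) fun S => S.monad.map (addPointIncl X) (z S) := by
  have hvar : ClosedUnderWeakening fun Y (z : ∀ S : B.Model, S.monad.obj Y) =>
      ∃ y, z = fun S => S.monad.unit y :=
    { unit := fun y => ⟨y, rfl⟩
      weaken := by
        rintro Y _ ⟨y, rfl⟩
        exact ⟨some y, funext fun S =>
          (NatTrans.naturality_apply S.monad.η (addPointIncl Y) y).symm⟩ }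
  have h (S : B.Model) := (MonadModule.tautological S.monad).map_eq_subst (addPointIncl X) (z S)
  simp only [h]
  refine hz.bind_of_closedUnderWeakening hvar ?_ fun x => ⟨some x, rfl⟩
  rintro Y _ ⟨y, rfl⟩
  exact var y

theorem bind (hf : ∀ x, Definable e Y fun S => f S x) (hz : Definable e X z) :
    Definable e Y fun S => S.monad.bind (f S) (z S) :=
  hz.bind_of_closedUnderWeakening ⟨var, weaken⟩ id hf

theorem hom_apply (hz : Definable e X z) {M N : B.Model} (f : M ⟶ N) : f.hom.app X (z M) = z N := by
  induction hz with
  | var x => exact SetMonad.hom_unit f.hom x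
  | op k z _ ih =>
    refine (Model.hom_op ((Model.restrict (e k)).map f) fun i => z i M).trans ?_
    exact congrArg (((Model.restrict (e k)).obj N).op (X := _)) (funext ih)

end Definable

/-- The set of variables available under a list of groups of binders. -/
abbrev Context (X : Type u) (l : List ℕ) : Type u :=
  l.foldr (fun m Y => Option^[m] Y) X

/-- Syntactic terms for operations of arities `s`, with variables from `X`, under a list of groups
of binders. They live in `Type u`, unlike families indexed by all models. -/
inductive Term (s : K → List ℕ) (X : Type u) : List ℕ → Type u
  | var {l : List ℕ} (x : Context X l) : Term s X l
  | op {l : List ℕ} (k : K) (a : ∀ i, Term s X ((s k).get i :: l)) : Term s X l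

/-- The interpretation of terms in all models. -/
def Term.eval {X : Type u} :
    {l : List ℕ} → Term s X l → ∀ S : B.Model, S.monad.obj (Context X l)
  | _, .var x, S => S.monad.unit x
  | _, .op k a, S => ((Model.restrict (e k)).obj S).op fun i => (a i).eval S

variable {e} in
theorem Definable.exists_term {X : Type u} {z : ∀ S : B.Model, S.monad.obj X}
    (hz : Definable e X z) : ∃ t : Term s X [], t.eval e = z := by
  suffices h : ∀ {Y : Type u} {z : ∀ S : B.Model, S.monad.obj Y}, Definable e Y z →
      ∀ l, Y = Context X l → ∃ t : Term s X l, t.eval e ≍ z by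
    obtain ⟨t, ht⟩ := h hz [] rfl
    exact ⟨t, eq_of_heq ht⟩
  intro Y z hz
  induction hz with
  | var x =>
    rintro l rfl
    exact ⟨.var x, HEq.rfl⟩
  | op k z _ ih =>
    rintro l rfl
    choose t ht using fun i => ih i ((s k).get i :: l) rfl
    obtain rfl : (fun i => (t i).eval e) = z := funext fun i => eq_of_heq (ht i)
    exact ⟨.op k t, HEq.rfl⟩

instance small_definable (X : Type u) : Small.{u} {z // Definable e X z} :=
  small_subset (t := {z | Definable e X z}) (s := Set.range fun t : Term s X [] => t.eval e)
    fun _ hz => hz.exists_term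

end Definable

/-! ### The initial model -/

/-- A family of signature morphisms is jointly surjective if every element of the target lies in
the image of one of them. -/
def JointlySurjective {B : Signature.{u}} {K : Type*} {A : K → Signature.{u}}
    (e : ∀ k, A k ⟶ B) : Prop :=
  ∀ (R : SetMonad.{u}) (X : Type u) (b : (B.obj R).functor.obj X),
    ∃ (k : K) (a : ((A k).obj R).functor.obj X), ((e k).app R).nat.app X a = b

section InitialModel

variable {B : Signature.{u}} {K : Type u} {s : K → List ℕ} (e : ∀ k, elementary (s k) ⟶ B)

/-- The definable families of elements of the models of `B`, as a type in the universe of sets. -/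
def DefinableFamily (X : Type u) : Type u :=
  Shrink.{u} {z // Definable e X z}

namespace DefinableFamily

variable {e} {X Y : Type u}

/-- The value of a definable family at a model. -/
noncomputable def eval (S : B.Model) (t : DefinableFamily e X) : S.monad.obj X :=
  ((equivShrink _).symm t).1 S

/-- A family that is definable, as an element of `DefinableFamily`. -/
noncomputable def mk (z : ∀ S : B.Model, S.monad.obj X) (h : Definable e X z) :
    DefinableFamily e X :=
  equivShrink _ ⟨z, h⟩

theorem eval_mk (z : ∀ S : B.Model, S.monad.obj X) (h : Definable e X z) (S : B.Model) :
    (mk z h).eval S = z S := by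
  rw [eval, mk, Equiv.symm_apply_apply]

theorem definable_eval (t : DefinableFamily e X) : Definable e X fun S => t.eval S :=
  ((equivShrink _).symm t).2

theorem ext {t t' : DefinableFamily e X} (h : ∀ S, t.eval S = t'.eval S) : t = t' :=
  (equivShrink _).symm.injective (Subtype.ext (funext h))

noncomputable instance : _root_.Monad (DefinableFamily e) where
  pure x := mk _ (.var x)
  bind t f := mk _ (t.definable_eval.bind fun x => (f x).definable_eval)

theorem eval_pure (S : B.Model) (x : X) :
    (pure x : DefinableFamily e X).eval S = S.monad.unit x :=
  eval_mk _ _ S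

theorem eval_bind (S : B.Model) (t : DefinableFamily e X) (f : X → DefinableFamily e Y) :
    (t >>= f).eval S = S.monad.bind (fun x => (f x).eval S) (t.eval S) :=
  eval_mk _ _ S

instance : LawfulMonad (DefinableFamily e) :=
  LawfulMonad.mk'
    (id_map := fun t => ext fun S => by
      change (t >>= pure).eval S = t.eval S
      simp only [eval_bind, eval_pure]
      exact (MonadModule.tautological S.monad).subst_unit _)
    (pure_bind := fun x f => ext fun S => by
      rw [eval_bind, eval_pure, SetMonad.bind_unit])
    (bind_assoc := fun t f g => ext fun S => by
      simp only [eval_bind]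
      exact MonadModule.subst_subst _ _ _ _)

end DefinableFamily

/-- The monad of definable families. -/
noncomputable def initialMonad : SetMonad.{u} :=
  ofTypeMonad (DefinableFamily e)

/-- Evaluation of definable families at a model, as a morphism of monads. -/
noncomputable def initialHom (S : B.Model) : initialMonad e ⟶ S.monad :=
  SetMonad.homOfBind (fun _ => DefinableFamily.eval S) (DefinableFamily.eval_pure S) fun f t =>
    (congrArg (DefinableFamily.eval S) (SetMonad.bind_ofTypeMonad (DefinableFamily e) f t)).trans
      (DefinableFamily.eval_bind S t f)

/-- The composite `B(R) ⟶ B(S) ⟶ S` for a model `S`, where `R` is the monad of definable families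
and the first arrow is induced by evaluation at `S`. -/
noncomputable def evalAction (S : B.Model) : B.obj (initialMonad e) ⟶
    (MonadModule.pullback (initialHom e S)).obj (.tautological S.monad) :=
  B.map (initialHom e S) ≫ (MonadModule.pullback (initialHom e S)).map S.action

variable {e}

theorem definable_evalAction (he : JointlySurjective e) {X : Type u}
    (b : (B.obj (initialMonad e)).functor.obj X) :
    Definable e X fun S => (evalAction e S).nat.app X b := by
  obtain ⟨k, a, rfl⟩ := he _ X b
  have evalAction_eq_op := funext fun S : B.Model =>
    (congrArg (S.action.nat.app X) (naturality_apply (e k) (initialHom e S) a)).symm.trans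
      (((Model.restrict (e k)).obj S).action_map (initialHom e S) a)
  refine (congrArg (Definable e X) evalAction_eq_op).mpr (.op k _ fun i => ?_)
  exact DefinableFamily.definable_eval (elementaryEquiv (initialMonad e) (s k) X a i)

/-- The action of `B` on definable families, computed separately at every model. -/
noncomputable def initialAction (he : JointlySurjective e) {X : Type u}
    (b : (B.obj (initialMonad e)).functor.obj X) : DefinableFamily e X :=
  .mk _ (definable_evalAction he b)

theorem eval_initialAction (he : JointlySurjective e) {X : Type u}
    (b : (B.obj (initialMonad e)).functor.obj X) (S : B.Model) :
    (initialAction he b).eval S = (evalAction e S).nat.app X b :=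
  DefinableFamily.eval_mk _ _ S

theorem initialAction_subst (he : JointlySurjective e) {X Y : Type u}
    (f : X → (initialMonad e).obj Y) (b : (B.obj (initialMonad e)).functor.obj X) :
    initialAction he ((B.obj (initialMonad e)).subst f b) =
      (initialMonad e).bind f (initialAction he b) := by
  refine DefinableFamily.ext fun S => ?_
  calc (initialAction he ((B.obj (initialMonad e)).subst f b)).eval S
      = S.monad.bind (fun x => (initialHom e S).app Y (f x)) ((evalAction e S).nat.app X b) :=
        (eval_initialAction he _ S).trans ((evalAction e S).app_subst_pullback f b)
    _ = S.monad.bind (fun x => (initialHom e S).app Y (f x)) ((initialAction he b).eval S) :=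
        congrArg _ (eval_initialAction he b S).symm
    _ = ((initialMonad e).bind f (initialAction he b) : DefinableFamily e Y).eval S :=
        (SetMonad.hom_bind (initialHom e S) f (initialAction he b)).symm

/-- The model of definable families. -/
noncomputable def initialModel (he : JointlySurjective e) : B.Model where
  monad := initialMonad e
  action := MonadModule.homOfSubst (fun _ => initialAction he) (initialAction_subst he)

/-- Evaluation at a model, as a morphism of models. -/
noncomputable def initialModelHom (he : JointlySurjective e) (S : B.Model) :
    initialModel he ⟶ S where
  hom := initialHom e S
  comm := by
    ext X b
    exact eval_initialAction he b S

theorem eval_initialModel (he : JointlySurjective e) {X : Type u} (t : DefinableFamily e X) :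
    t.eval (initialModel he) = t :=
  DefinableFamily.ext fun S => t.definable_eval.hom_apply (initialModelHom he S)

theorem initialModel_hom_ext (he : JointlySurjective e) {S : B.Model}
    (f g : initialModel he ⟶ S) : f = g := by
  have eq_eval (f : initialModel he ⟶ S) (X : Type u) (t : DefinableFamily e X) :
      f.hom.app X t = t.eval S :=
    (congrArg (f.hom.app X) (eval_initialModel he t)).symm.trans (t.definable_eval.hom_apply f)
  exact Model.Hom.ext (SetMonad.hom_ext fun X t => (eq_eval f X t).trans (eq_eval g X t).symm)

/-- The model of definable families is initial. -/
noncomputable def isInitialInitialModel (he : JointlySurjective e) : IsInitial (initialModel he) :=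
  IsInitial.ofUniqueHom (initialModelHom he) fun _ _ => initialModel_hom_ext he _ _

end InitialModel

/-! ### Subsignatures and colimits -/

/-- A subsignature: subsets of all `B(R)(X)` that are stable under renaming of variables, under the
action of `R` and under change of the monad `R`. -/
structure Subsignature (B : Signature.{u}) where
  obj (R : SetMonad.{u}) : Subfunctor (B.obj R).functor
  act_mem {R : SetMonad.{u}} {X : Type u} {b : (B.obj R).functor.obj (R.obj X)} :
    b ∈ (obj R).obj (R.obj X) → (B.obj R).act.app X b ∈ (obj R).obj X
  map_mem {R S : SetMonad.{u}} (f : R ⟶ S) {X : Type u} {b : (B.obj R).functor.obj X} :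
    b ∈ (obj R).obj X → (B.map f).nat.app X b ∈ (obj S).obj X

namespace Subsignature

variable {A B : Signature.{u}} (P : B.Subsignature)

/-- The module over `R` formed by the elements of a subsignature. -/
def module (R : SetMonad.{u}) : MonadModule R where
  functor := (P.obj R).toFunctor
  act :=
    { app X := ↾fun b => ⟨(B.obj R).act.app X b.1, P.act_mem b.2⟩
      naturality X Y g := by
        ext b
        exact Subtype.ext (NatTrans.naturality_apply (B.obj R).act g b.1 :) }
  act_act X := by
    ext b
    exact Subtype.ext (ConcreteCategory.congr_hom ((B.obj R).act_act X) b.1 :)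
  act_unit X := by
    ext b
    exact Subtype.ext (ConcreteCategory.congr_hom ((B.obj R).act_unit X) b.1 :)

/-- A subsignature as a signature. -/
def toSignature : Signature.{u} where
  obj := P.module
  map f :=
    { nat :=
        { app X := ↾fun b => ⟨(B.map f).nat.app X b.1, P.map_mem f b.2⟩
          naturality X Y g := by
            ext b
            exact Subtype.ext (NatTrans.naturality_apply (B.map f).nat g b.1 :) }
      linear X := by
        ext b
        exact Subtype.ext (ConcreteCategory.congr_hom ((B.map f).linear X) b.1 :) }
  map_id R := by
    ext X b
    exact Subtype.ext (ConcreteCategory.congr_hom (NatTrans.congr_app (B.map_id R) X) b.1 :)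
  map_comp f g := by
    ext X b
    exact Subtype.ext (ConcreteCategory.congr_hom (NatTrans.congr_app (B.map_comp f g) X) b.1 :)

/-- The inclusion of a subsignature. -/
def ι : P.toSignature ⟶ B where
  app R := { nat := (P.obj R).ι, linear := fun _ => rfl }
  naturality _ := rfl

instance : Mono P.ι where
  right_cancellation m n h := by
    ext R : 2
    exact (cancel_mono (P.obj R).ι).1 (congrArg (fun q => (Hom.app q R).nat) h)

/-- The factorization of a morphism through a subsignature that contains its range. -/
def lift (m : A ⟶ B) (hm : ∀ R, Subfunctor.range (m.app R).nat ≤ P.obj R) :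
    A ⟶ P.toSignature where
  app R :=
    { nat := Subfunctor.lift (m.app R).nat (hm R)
      linear X := by
        ext a
        exact Subtype.ext (ConcreteCategory.congr_hom ((m.app R).linear X) a :) }
  naturality f := by
    ext X a
    exact Subtype.ext (naturality_apply m f a)

theorem lift_ι (m : A ⟶ B) (hm : ∀ R, Subfunctor.range (m.app R).nat ≤ P.obj R) :
    P.lift m hm ≫ P.ι = m :=
  rfl

/-- The joint range of a family of morphisms of signatures. -/
def jointRange {K : Type*} {A : K → Signature.{u}} (e : ∀ k, A k ⟶ B) : B.Subsignature where
  obj R :=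
    { obj X := {b | ∃ k a, ((e k).app R).nat.app X a = b}
      map {X Y} g := by
        rintro _ ⟨k, a, rfl⟩
        exact ⟨k, _, NatTrans.naturality_apply ((e k).app R).nat g a⟩ }
  act_mem {R X} := by
    rintro _ ⟨k, a, rfl⟩
    exact ⟨k, _, ConcreteCategory.congr_hom (((e k).app R).linear X) a⟩
  map_mem {R S} f {X} := by
    rintro _ ⟨k, a, rfl⟩
    exact ⟨k, ((A k).map f).nat.app X a, naturality_apply (e k) f a⟩

end Subsignature

theorem jointlySurjective_of_isColimit {J : Type*} [Category J] {F : J ⥤ Signature.{u}}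
    {c : Cocone F} (hc : IsColimit c) : JointlySurjective fun j => c.ι.app j := by
  intro R X b
  let P := Subsignature.jointRange fun j => c.ι.app j
  let d : Cocone F :=
    { pt := P.toSignature
      ι :=
        { app j := P.lift (c.ι.app j) fun R => by
            rintro X _ ⟨a, rfl⟩
            exact ⟨j, a, rfl⟩
          naturality i j f := by
            rw [← cancel_mono P.ι]
            exact c.ι.naturality f } }
  have desc_ι : hc.desc d ≫ P.ι = 𝟙 c.pt := hc.hom_ext fun j => by
    rw [hc.fac_assoc, Category.comp_id]
    exact P.lift_ι _ _
  have hb := ConcreteCategory.congr_hom (NatTrans.congr_app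
    (congrArg (fun m : c.pt ⟶ c.pt => (m.app R).nat) desc_ι) X) b
  obtain ⟨j, a, ha⟩ := (((hc.desc d).app R).nat.app X b).2
  exact ⟨j, a, ha.trans hb⟩

theorem JointlySurjective.comp {B : Signature.{u}} {K : Type*} {A : K → Signature.{u}}
    {e : ∀ k, A k ⟶ B} (he : JointlySurjective e) {I : K → Type*}
    {A' : ∀ k, I k → Signature.{u}} {p : ∀ k i, A' k i ⟶ A k}
    (hp : ∀ k, JointlySurjective (p k)) :
    JointlySurjective fun l : Σ k, I k => p l.1 l.2 ≫ e l.1 := by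
  intro R X b
  obtain ⟨k, a, rfl⟩ := he R X b
  obtain ⟨i, a', rfl⟩ := hp k R X a
  exact ⟨⟨k, i⟩, a', rfl⟩

theorem JointlySurjective.reindex {B : Signature.{u}} {K L : Type*} {A : K → Signature.{u}}
    {e : ∀ k, A k ⟶ B} (he : JointlySurjective e) {f : L → K} (hf : Function.Surjective f) :
    JointlySurjective fun l => e (f l) := by
  intro R X b
  obtain ⟨k, a, rfl⟩ := he R X b
  obtain ⟨l, rfl⟩ := hf k
  exact ⟨l, a, rfl⟩

/-! ### Presentable signatures -/

/-- A presentable signature: one that is jointly covered by a set of elementary signatures. -/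
def IsPresentable (B : Signature.{u}) : Prop :=
  ∃ (K : Type u) (s : K → List ℕ) (e : ∀ k, elementary (s k) ⟶ B), JointlySurjective e

theorem IsAlgebraic.isPresentable {A : Signature.{u}} (hA : A.IsAlgebraic) : A.IsPresentable := by
  obtain ⟨I, s, ι, ⟨hι⟩⟩ := hA
  refine ⟨I, s, ι, fun R X b => ?_⟩
  obtain ⟨⟨i⟩, a, ha⟩ := jointlySurjective_of_isColimit hι R X b
  exact ⟨i, a, ha⟩

theorem isPresentable_of_jointlySurjective {B : Signature.{u}} {K : Type*} [Small.{u} K]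
    {A : K → Signature.{u}} (hA : ∀ k, (A k).IsPresentable) {e : ∀ k, A k ⟶ B}
    (he : JointlySurjective e) : B.IsPresentable := by
  choose I s p hp using hA
  exact ⟨_, _, _, (he.comp hp).reindex (equivShrink.{u} (Σ k, I k)).symm.surjective⟩

theorem IsPresentable.isRepresentable {B : Signature.{u}} (hB : B.IsPresentable) :
    B.IsRepresentable := by
  obtain ⟨K, s, e, he⟩ := hB
  exact (isInitialInitialModel he).hasInitial

end Signature

theorem corollary7p6_general {J : Type*} [Category J] [Small.{u} J] (F : J ⥤ Signature.{u})
    (hF : ∀ j : J, (F.obj j).IsPresentable) (c : Cocone F) (hc : IsColimit c) :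
    c.pt.IsRepresentable :=
  (Signature.isPresentable_of_jointlySurjective hF
    (Signature.jointlySurjective_of_isColimit hc)).isRepresentable

theorem corollary7p6 {J : Type u} [SmallCategory J] (F : J ⥤ Signature.{u})
    (hF : ∀ j : J, (F.obj j).IsAlgebraic) (c : Cocone F) (hc : IsColimit c) :
    c.pt.IsRepresentable :=
  corollary7p6_general F (fun j => (hF j).isPresentable) c hc
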